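/- Let $\ell\ge 1$, let $k_1,\dots,k_\ell$ be nonzero real numbers and $n_1,\dots,n_\ell$ natural numbers. Let $\mathbb{R}^{N_i}$ be $\mathbb{R}^{n_i+1}$ with the Euclidean scalar product if $k_i>0$, and with the Lorentzian scalar product $-x_0y_0+\sum_{j\ge1}x_jy_j$ if $k_i<0$. Let $\mathbb{O}_{k_i}^{n_i}=\{x\in\mathbb{R}^{N_i} : \langle x,x\rangle=1/k_i\}$, with the additional condition $x_0>0$ if $k_i<0$ (the sphere, respectively the hyperbolic space, of curvature $k_i$). Let $\hat{\mathbb{O}}=\mathbb{O}_{k_1}^{n_1}\times\cdots\times\mathbb{O}_{k_\ell}^{n_\ell}\subset\mathbb{R}^N=\mathbb{R}^{N_1}\times\cdots\times\mathbb{R}^{N_\ell}$, where $\mathbb{R}^N$ carries the sum of the scalar products of the factors, and let $\|Z\|^2=\langle Z,Z\rangle$, which may be negative. Let $\pi_i:\mathbb{R}^N\to\mathbb{R}^N$, $\pi_i(x_1,\dots,x_\ell)=(0,\dots,0,x_i,0,\dots,0)$. Let $M$ be a nonempty Riemannian manifold of dimension $m\ge1$, let $f:M\to\hat{\mathbb{O}}$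 be a smooth isometric immersion and $F:M\to\mathbb{R}^N$ its composition with the inclusion $\hat{\mathbb{O}}\subset\mathbb{R}^N$. Let $T_x^\perp M$ be the orthogonal complement of $f_*T_xM$ in $T_{f(x)}\hat{\mathbb{O}}$, let $\alpha$ be the second fundamental form of $f$, $\nabla^\perp$ its normal connection, and $\mathcal{N}_1(x)=\operatorname{span}\{\alpha(X,Y): X,Y\in T_xM\}\subset T_x^\perp M$ its first normal space. Put $\mathbf{L}_i=\pi_i\circ f_*$ on $TM$ and $\mathbf{K}_i=\pi_i|_{T^\perp M}$, both with values in $T\hat{\mathbb{O}}$, and, with $\dagger$ denoting adjoints, $\mathbf{R}_i=\mathbf{L}_i^\dagger\mathbf{L}_i:TM\to TM$ and $\mathbf{S}_i=\mathbf{K}_i^\dagger\mathbf{L}_i:TM\to T^\perp M$. A linear map $A$ is called a similarity of ratio $a>0$ if $\langle AX,AY\rangle=a^2\langle X,Y\rangle$ for all $X,Y$. Assume that $k_i\mathbf{R}_i=k_j\mathbf{R}_j$ for all $i,j\in\{1,\dots,\ell\}$. Let $M_i=\prod_{j\ne i}k_j$ and $\lambda=\sum_{i=1}^{\ell}M_i$.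 Then: (I) $\lambda\neq0$. (II) $\mathbf{R}_i=\lambda_i\,\mathrm{Id}$ for every $i$, where $\lambda_i=M_i/\lambda$. (III) $k_ik_j>0$ for all $i,j$. (IV) At every point of $M$ and for every $i$, $\mathbf{L}_i$ is a similarity of ratio $a_i=\sqrt{\lambda_i}$ (in particular $\lambda_i>0$). (V) $\|\pi_iF\|^2=a_i^2\|F\|^2$ on $M$ for every $i$. (VI) $\mathcal{N}_1(x)\perp\mathbf{S}_i(T_xM)$ for every $x\in M$ and every $i$. (VII) If $\mathcal{N}_1$ is parallel in the normal connection of $f$, that is, $\nabla^\perp_X\xi\in\mathcal{N}_1$ for every smooth local section $\xi$ of $T^\perp M$ with values in $\mathcal{N}_1$ and every tangent vector $X$, then for every $x\in M$ and every $i$ the restriction $\pi_i|_{\mathcal{N}_1(x)}$ is a similarity of ratio $a_i$. -/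

import Mathlib

open scoped Manifold ContDiff Topology Bundle

noncomputable section

namespace ProdSpaceForms

/-! ### The ambient space and the product of space forms -/

/-- `v(k) = 1` if `k ≠ 0` and `v(0) = 0`. -/
def v (k : ℝ) : ℕ := if k = 0 then 0 else 1

/-- The signs of the flat metric of the factor with curvature `k`: the coordinate of index `0` is
timelike if `k < 0`, and every other coordinate is spacelike. -/
def sgn (k : ℝ) {N : ℕ} (j : Fin N) : ℝ := if k < 0 ∧ j.val = 0 then -1 else 1

/-- The (Euclidean if `k ≥ 0`, Lorentzian if `k < 0`) scalar product of the factor `ℝ^N`. -/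
def scalar (k : ℝ) {N : ℕ} : LinearMap.BilinForm ℝ (Fin N → ℝ) :=
  LinearMap.mk₂ ℝ (fun x y => ∑ j, sgn k j * x j * y j)
    (fun x x' y => by simp only [Pi.add_apply, mul_add, add_mul, Finset.sum_add_distrib])
    (fun c x y => by
      simp only [Pi.smul_apply, smul_eq_mul, Finset.mul_sum]
      exact Finset.sum_congr rfl fun j _ => by ring)
    (fun x y y' => by simp only [Pi.add_apply, mul_add, Finset.sum_add_distrib])
    (fun c x y => by
      simp only [Pi.smul_apply, smul_eq_mul, Finset.mul_sum]
      exact Finset.sum_congr rfl fun j _ => by ring)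

/-- The model of the `n`-dimensional space form of curvature `k` in `ℝ^{n + v(k)}`: the Euclidean
space if `k = 0`, the sphere `⟨x, x⟩ = 1/k` if `k > 0`, and the sheet `x₀ > 0` of the hyperboloid
`⟨x, x⟩ = 1/k` if `k < 0`. -/
def spaceForm (k : ℝ) (n : ℕ) : Set (Fin (n + v k) → ℝ) :=
  {x | (k ≠ 0 → scalar k x x = 1 / k) ∧ (k < 0 → ∀ j, j.val = 0 → 0 < x j)}

variable {ℓ : ℕ}

/-- The space `ℝ^N = ∏ i, ℝ^{n i + v (k i)}`. -/
abbrev Ambient (k : Fin ℓ → ℝ) (n : Fin ℓ → ℕ) : Type :=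
  (i : Fin ℓ) → Fin (n i + v (k i)) → ℝ

/-- The flat (possibly indefinite) metric of `ℝ^N`, the sum of the scalar products of the
factors. -/
def flat (k : Fin ℓ → ℝ) (n : Fin ℓ → ℕ) : LinearMap.BilinForm ℝ (Ambient k n) :=
  ∑ i, (scalar (k i)).compl₁₂ (LinearMap.proj i) (LinearMap.proj i)

/-- The orthogonal projection `π_i (x_1, …, x_ℓ) = (0, …, 0, x_i, 0, …, 0)` of `ℝ^N`. -/
def proj (k : Fin ℓ → ℝ) (n : Fin ℓ → ℕ) (i : Fin ℓ) : Ambient k n →ₗ[ℝ] Ambient k n :=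
  LinearMap.single ℝ (fun i => Fin (n i + v (k i)) → ℝ) i ∘ₗ LinearMap.proj i

/-- The product `Ô` of the space forms of curvature `k i` and dimension `n i`, as a subset of
`ℝ^N`. -/
def prodSpaceForm (k : Fin ℓ → ℝ) (n : Fin ℓ → ℕ) : Set (Ambient k n) :=
  {p | ∀ i, p i ∈ spaceForm (k i) (n i)}

/-- The tangent space of `Ô` at `p`, as a subspace of `ℝ^N`: the common kernel of the differentials
`Z ↦ 2 ⟨p_i, Z_i⟩` of the equations `⟨x_i, x_i⟩ = 1/k_i`, `k_i ≠ 0`, that define `Ô`. -/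
def tangentProd (k : Fin ℓ → ℝ) (n : Fin ℓ → ℕ) (p : Ambient k n) :
    Submodule ℝ (Ambient k n) where
  carrier := {Z | ∀ i, k i ≠ 0 → scalar (k i) (p i) (Z i) = 0}
  zero_mem' := fun i _ => by simp
  add_mem' := fun {Z W} hZ hW i hi => by simp [hZ i hi, hW i hi]
  smul_mem' := fun c Z hZ i hi => by simp [hZ i hi]

/-! ### Adjoints -/

/-- The adjoint `A†` of a linear map `A : V → W` between spaces with bilinear forms, that is,
the map with `⟨A† w, x⟩ = ⟨w, A x⟩`. It exists and is unique if `V` is finite-dimensional and its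
form is nondegenerate; it is set to `0` if it does not exist. -/
def adjoint {V W : Type*} [AddCommGroup V] [Module ℝ V] [AddCommGroup W] [Module ℝ W]
    (BV : LinearMap.BilinForm ℝ V) (BW : LinearMap.BilinForm ℝ W) (A : V →ₗ[ℝ] W) : W →ₗ[ℝ] V :=
  open Classical in
  if h : ∃ G : W →ₗ[ℝ] V, ∀ w x, BV (G w) x = BW w (A x) then h.choose else 0

theorem adjoint_apply {V W : Type*} [AddCommGroup V] [Module ℝ V] [FiniteDimensional ℝ V]
    [AddCommGroup W] [Module ℝ W] (BV : LinearMap.BilinForm ℝ V) (BW : LinearMap.BilinForm ℝ W)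
    (hV : BV.Nondegenerate) (A : V →ₗ[ℝ] W) (w : W) (x : V) :
    BV (adjoint BV BW A w) x = BW w (A x) := by
  have h : ∃ G : W →ₗ[ℝ] V, ∀ w x, BV (G w) x = BW w (A x) :=
    ⟨(BV.toDual hV).symm.toLinearMap ∘ₗ A.dualMap ∘ₗ BW, fun w x => by
      simp [LinearMap.BilinForm.apply_toDual_symm_apply]⟩
  rw [adjoint, dif_pos h]
  exact h.choose_spec w x

/-- A linear similarity of ratio `a` between spaces with bilinear forms. -/
def IsSimilarity {V W : Type*} [AddCommMonoid V] [Module ℝ V] [AddCommMonoid W] [Module ℝ W]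
    (BV : LinearMap.BilinForm ℝ V) (BW : LinearMap.BilinForm ℝ W) (A : V →ₗ[ℝ] W) (a : ℝ) : Prop :=
  0 < a ∧ ∀ x y, BW (A x) (A y) = a ^ 2 * BV x y

/-! ### Isometric immersions into `Ô` -/

section Immersion

variable {k : Fin ℓ → ℝ} {n : Fin ℓ → ℕ} {m : ℕ} {M : Type*} [TopologicalSpace M]
  [ChartedSpace (EuclideanSpace ℝ (Fin m)) M] [IsManifold (𝓡 m) ∞ M]

/-- A smooth Riemannian metric on `M`. -/
abbrev RiemMetric (m : ℕ) (M : Type*) [TopologicalSpace M]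
    [ChartedSpace (EuclideanSpace ℝ (Fin m)) M] [IsManifold (𝓡 m) ∞ M] :=
  Bundle.ContMDiffRiemannianMetric (𝓡 m) ∞ (EuclideanSpace ℝ (Fin m))
    (fun x : M => TangentSpace (𝓡 m) x)

/-- The scalar product of `T_x M` as a bilinear form. -/
def metricForm (g : RiemMetric m M) (x : M) : LinearMap.BilinForm ℝ (TangentSpace (𝓡 m) x) :=
  ContinuousLinearMap.coeLM ℝ ∘ₗ (g.inner x).toLinearMap

/-- The differential `F_* : T_x M → ℝ^N` of a map `F : M → ℝ^N`. -/
def push (F : M → Ambient k n) (x : M) : TangentSpace (𝓡 m) x →ₗ[ℝ] Ambient k n :=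
  (mfderiv (𝓡 m) 𝓘(ℝ, Ambient k n) F x).toLinearMap

/-- `F = ι ∘ f` for an isometric immersion `f : M → Ô`, where `ι : Ô → ℝ^N` is the inclusion: `F` is
smooth, takes values in `Ô` and its differential preserves scalar products (so it is injective). -/
structure IsIsometricImmersion (g : RiemMetric m M) (F : M → Ambient k n) : Prop where
  smooth : ContMDiff (𝓡 m) 𝓘(ℝ, Ambient k n) ∞ F
  mem : ∀ x, F x ∈ prodSpaceForm k n
  isometric : ∀ x X Y, flat k n (push F x X) (push F x Y) = metricForm g x X Y

/-- `L_i = π_i ∘ f_*`, a map from `T_x M` into the tangent space of `Ô`, which is viewed as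
a subspace of `ℝ^N`. -/
def tensorL (F : M → Ambient k n) (i : Fin ℓ) (x : M) :
    TangentSpace (𝓡 m) x →ₗ[ℝ] Ambient k n :=
  proj k n i ∘ₗ push F x

/-- `R_i = L_i† L_i`. -/
def tensorR (g : RiemMetric m M) (F : M → Ambient k n) (i : Fin ℓ) (x : M) :
    TangentSpace (𝓡 m) x →ₗ[ℝ] TangentSpace (𝓡 m) x :=
  adjoint (metricForm g x) (flat k n) (tensorL F i x) ∘ₗ tensorL F i x

variable (m)

/-- The normal space `T_x^⊥ M` of `f` at `x`, the orthogonal complement of `f_* T_x M` in the tangent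
space of `Ô` at `f(x)`. -/
def normalSpace (F : M → Ambient k n) (x : M) : Submodule ℝ (Ambient k n) where
  carrier := {Z | Z ∈ tangentProd k n (F x) ∧
    ∀ X : TangentSpace (𝓡 m) x, flat k n Z (push F x X) = 0}
  zero_mem' := ⟨Submodule.zero_mem _, fun X => by simp⟩
  add_mem' := fun {Z W} hZ hW =>
    ⟨Submodule.add_mem _ hZ.1 hW.1, fun X => by simp [hZ.2 X, hW.2 X]⟩
  smul_mem' := fun c Z hZ => ⟨Submodule.smul_mem _ c hZ.1, fun X => by simp [hZ.2 X]⟩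

/-- The scalar product of the normal space. -/
def normalForm (F : M → Ambient k n) (x : M) : LinearMap.BilinForm ℝ (normalSpace m F x) :=
  (flat k n).restrict (normalSpace m F x)

/-- The orthogonal projection of `ℝ^N` onto `T_x^⊥ M`, i.e. the adjoint of the inclusion. -/
def normalProj (F : M → Ambient k n) (x : M) : Ambient k n →ₗ[ℝ] normalSpace m F x :=
  adjoint (normalForm m F x) (flat k n) (normalSpace m F x).subtype

/-- `K_i = π_i` restricted to `T_x^⊥ M`. -/
def tensorK (F : M → Ambient k n) (i : Fin ℓ) (x : M) :
    normalSpace m F x →ₗ[ℝ] Ambient k n :=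
  proj k n i ∘ₗ (normalSpace m F x).subtype

/-- `S_i = K_i† L_i`. -/
def tensorS (F : M → Ambient k n) (i : Fin ℓ) (x : M) :
    TangentSpace (𝓡 m) x →ₗ[ℝ] normalSpace m F x :=
  adjoint (normalForm m F x) (flat k n) (tensorK m F i x) ∘ₗ tensorL F i x

/-- The second fundamental form `α(X, Y) = (∇̄_X f_* Y)^⊥` of `f : M → Ô`. Here `Y` is extended by the
vector field with constant coordinates in the chart at `x`, in which tangent vectors at `x` are
expressed, so that the derivative of `F_* Y` in the direction `X` is the second derivative of `F`
in that chart. The Levi-Civita connection `∇̄` of `Ô` is the tangential part of this derivative, and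
`T_x^⊥ M` lies in the tangent space of `Ô`, so the derivative is projected to `T_x^⊥ M` directly. -/
def secondForm (F : M → Ambient k n) (x : M) (X Y : TangentSpace (𝓡 m) x) : normalSpace m F x :=
  normalProj m F x (fderiv ℝ (fderiv ℝ (F ∘ (extChartAt (𝓡 m) x).symm)) (extChartAt (𝓡 m) x x)
    (X : EuclideanSpace ℝ (Fin m)) (Y : EuclideanSpace ℝ (Fin m)))

/-- The first normal space `N_1(x) = span {α(X, Y) | X, Y ∈ T_x M}`. -/
def firstNormal (F : M → Ambient k n) (x : M) : Submodule ℝ (normalSpace m F x) :=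
  Submodule.span ℝ {ξ | ∃ X Y : TangentSpace (𝓡 m) x, ξ = secondForm m F x X Y}

/-- The normal connection `∇^⊥_X ξ` of `f : M → Ô`: the normal part of the derivative of the normal
field `ξ` in the direction `X ∈ T_x M`. -/
def normalConnection (F : M → Ambient k n) (ξ : (y : M) → normalSpace m F y) (x : M)
    (X : TangentSpace (𝓡 m) x) : normalSpace m F x :=
  normalProj m F x (push (m := m) (fun y => (ξ y : Ambient k n)) x X)

/-- `N_1` is parallel in the normal connection: `∇^⊥_X ξ` lies in `N_1` for every smooth local section
`ξ` of `N_1` and all tangent vectors `X`. -/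
def FirstNormalParallel (F : M → Ambient k n) : Prop :=
  ∀ (U : Set M) (ξ : (y : M) → normalSpace m F y), IsOpen U →
    ContMDiffOn (𝓡 m) 𝓘(ℝ, Ambient k n) ∞ (fun y => (ξ y : Ambient k n)) U →
    (∀ y ∈ U, ξ y ∈ firstNormal m F y) →
    ∀ x ∈ U, ∀ X : TangentSpace (𝓡 m) x, normalConnection m F ξ x X ∈ firstNormal m F x

end Immersion

/-- `M_i`, the product of the `k_j` with `j ≠ i`. -/
def prodOthers (k : Fin ℓ → ℝ) (i : Fin ℓ) : ℝ := ∏ j ∈ Finset.univ.erase i, k j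

/-- `λ = ∑ i, M_i`. -/
def lam (k : Fin ℓ → ℝ) : ℝ := ∑ i, prodOthers k i

/-- `a_i = √(M_i / λ)`. -/
def ratio (k : Fin ℓ → ℝ) (i : Fin ℓ) : ℝ := √(prodOthers k i / lam k)

end ProdSpaceForms

end

open scoped Manifold ContDiff Topology Bundle

noncomputable section

namespace ProdSpaceForms

section LinearAlgebra

/-! ### The scalar products -/

/-! The projections `π_i` are self-adjoint and sum to the identity, so the `R_i` sum to `Id`.
Proportionality of the `R_i` therefore gives `⟨X, Y⟩ = k_i s ⟨π_i f_* X, π_i f_* Y⟩` with `s = ∑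
1/k_j` (`metricForm_eq`). As the metric is not zero, `s ≠ 0`; since `M_i / λ = (1/k_i) / s`, this is
(I), (II) and the identity in (IV). The flat form is positive on tangent vectors of `Ô`
(`scalar_self_pos`), which makes each `λ_i` positive and hence all `k_i` of one sign. (V) holds
because `‖π_i F‖² = 1/k_i` and `‖F‖² = s`.

For the normal directions, consider the constant form `B = ⟨π_i ·, π_i ·⟩ - λ_i ⟨·, ·⟩` on `ℝ^N`
(`defect`). It vanishes on `f_* TM`, so by the Koszul argument second derivatives of `F` are
`B`-orthogonal to `f_* TM`. Their tangential and position parts contribute nothing to this pairing,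
so `B(α(X, Y), f_* Z) = 0`, which is (VI).

For (VII), extend `α(X, Y)` to a smooth section `ζ` of `N_1` and differentiate `B(ζ, F_* Z) = 0`
along `W`. Parallelism kills the term with the derivative of `ζ`; what remains is `B(α(X, Y), α(W,
Z)) = 0` (`defect_secondForm`). -/

theorem scalar_apply (k : ℝ) {N : ℕ} (x y : Fin N → ℝ) :
    scalar k x y = ∑ j, sgn k j * x j * y j := rfl

theorem scalar_symm (k : ℝ) {N : ℕ} (x y : Fin N → ℝ) : scalar k x y = scalar k y x := by
  simp only [scalar_apply]
  exact Finset.sum_congr rfl fun j _ => by ring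

/-- The scalar product is positive definite on the tangent spaces of a space form. -/
theorem scalar_self_pos {k : ℝ} (hk : k ≠ 0) {N : ℕ} {p Z : Fin N → ℝ}
    (hp : scalar k p p = 1 / k) (hZ : scalar k p Z = 0) (hZ0 : Z ≠ 0) : 0 < scalar k Z Z := by
  rcases lt_or_gt_of_ne hk with hneg | hpos
  · cases N with
    | zero => exact absurd (Subsingleton.elim Z 0) hZ0
    | succ N =>
      have key : ∀ x y : Fin (N + 1) → ℝ,
          scalar k x y = -(x 0 * y 0) + ∑ j : Fin N, x j.succ * y j.succ := by
        intro x y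
        rw [scalar_apply, Fin.sum_univ_succ]
        simp [sgn, hneg]
      rw [key] at hp hZ ⊢
      -- Reversed Cauchy–Schwarz: `A < p₀²` on the hyperboloid and `C = p₀ Z₀` by tangency, so `(p₀
      -- Z₀)² ≤ A B < p₀² B` once `B > 0`; and `B = 0` would force `Z = 0`.
      have cs := Finset.sum_mul_sq_le_sq_mul_sq Finset.univ
        (fun j : Fin N => p j.succ) (fun j : Fin N => Z j.succ)
      simp only [pow_two] at cs
      set A := ∑ j : Fin N, p j.succ * p j.succ
      set B := ∑ j : Fin N, Z j.succ * Z j.succ with hB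
      set C := ∑ j : Fin N, p j.succ * Z j.succ
      have hA : 0 ≤ A := Finset.sum_nonneg fun j _ => mul_self_nonneg _
      have hk' : 1 / k < 0 := one_div_neg.mpr hneg
      have hBnn : 0 ≤ B := Finset.sum_nonneg fun j _ => mul_self_nonneg _
      have hp0 : 0 < p 0 * p 0 := by linarith
      have hC : C = p 0 * Z 0 := by linarith
      rw [hC] at cs
      have hBpos : 0 < B := by
        rcases hBnn.lt_or_eq with h | h
        · exact h
        · exfalso
          rw [← h] at cs
          have h0 : Z 0 = 0 := by
            have h1 : (p 0 * Z 0) * (p 0 * Z 0) = 0 :=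
              le_antisymm (by linarith) (mul_self_nonneg _)
            rcases mul_eq_zero.mp (mul_self_eq_zero.mp h1) with h2 | h2
            · simp [h2] at hp0
            · exact h2
          have h3 := (Finset.sum_eq_zero_iff_of_nonneg
            (fun j _ => mul_self_nonneg (Z (Fin.succ j)))).mp (hB.symm.trans h.symm)
          apply hZ0
          funext j
          refine Fin.cases h0 (fun i => ?_) j
          exact mul_self_eq_zero.mp (h3 i (Finset.mem_univ i))
      have h4 : A < p 0 * p 0 := by linarith
      have h5 : (p 0 * p 0) * (Z 0 * Z 0) < (p 0 * p 0) * B := by nlinarith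
      have := lt_of_mul_lt_mul_left h5 hp0.le
      linarith
  · have key : scalar k Z Z = ∑ j, Z j * Z j := by
      rw [scalar_apply]
      exact Finset.sum_congr rfl fun j _ => by simp [sgn, hpos.not_gt]
    rw [key]
    refine lt_of_le_of_ne (Finset.sum_nonneg fun j _ => mul_self_nonneg _) fun h => hZ0 ?_
    funext j
    have := (Finset.sum_eq_zero_iff_of_nonneg (fun j _ => mul_self_nonneg (Z j))).mp h.symm j
      (Finset.mem_univ j)
    exact mul_self_eq_zero.mp this

variable {ℓ : ℕ} {k : Fin ℓ → ℝ} {n : Fin ℓ → ℕ}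

theorem flat_apply (Z W : Ambient k n) : flat k n Z W = ∑ i, scalar (k i) (Z i) (W i) := by
  simp [flat, LinearMap.sum_apply]

theorem flat_symm (Z W : Ambient k n) : flat k n Z W = flat k n W Z := by
  simp only [flat_apply]
  exact Finset.sum_congr rfl fun i _ => scalar_symm _ _ _

theorem proj_same (i : Fin ℓ) (Z : Ambient k n) : proj k n i Z i = Z i := by
  simp [proj]

theorem proj_of_ne {i j : Fin ℓ} (h : j ≠ i) (Z : Ambient k n) : proj k n i Z j = 0 := by
  simp [proj, Pi.single_eq_of_ne h]

theorem flat_proj_left (i : Fin ℓ) (Z W : Ambient k n) :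
    flat k n (proj k n i Z) W = scalar (k i) (Z i) (W i) := by
  rw [flat_apply, Finset.sum_eq_single i]
  · rw [proj_same]
  · intro j _ hj
    rw [proj_of_ne hj, map_zero, LinearMap.zero_apply]
  · simp

theorem flat_proj_right (i : Fin ℓ) (Z W : Ambient k n) :
    flat k n Z (proj k n i W) = scalar (k i) (Z i) (W i) := by
  rw [flat_symm, flat_proj_left, scalar_symm]

theorem flat_proj_proj (i : Fin ℓ) (Z W : Ambient k n) :
    flat k n (proj k n i Z) (proj k n i W) = scalar (k i) (Z i) (W i) := by
  rw [flat_proj_left, proj_same]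

theorem sum_flat_proj (Z W : Ambient k n) : ∑ i, flat k n (proj k n i Z) W = flat k n Z W := by
  rw [flat_apply]
  exact Finset.sum_congr rfl fun i _ => flat_proj_left i Z W

theorem scalar_self_of_mem {p : Ambient k n} (hp : p ∈ prodSpaceForm k n) {i : Fin ℓ}
    (hk : k i ≠ 0) : scalar (k i) (p i) (p i) = 1 / k i := (hp i).1 hk

theorem scalar_nonneg_of_mem (hk : ∀ i, k i ≠ 0) {p Z : Ambient k n} (hp : p ∈ prodSpaceForm k n)
    (hZ : Z ∈ tangentProd k n p) (i : Fin ℓ) : 0 ≤ scalar (k i) (Z i) (Z i) := by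
  rcases eq_or_ne (Z i) 0 with h | h
  · simp [h]
  · exact (scalar_self_pos (hk i) (scalar_self_of_mem hp (hk i)) (hZ i (hk i)) h).le

theorem flat_self_pos (hk : ∀ i, k i ≠ 0) {p Z : Ambient k n} (hp : p ∈ prodSpaceForm k n)
    (hZ : Z ∈ tangentProd k n p) (hZ0 : Z ≠ 0) : 0 < flat k n Z Z := by
  obtain ⟨i, hi⟩ := Function.ne_iff.mp hZ0
  rw [flat_apply]
  exact Finset.sum_pos' (fun j _ => scalar_nonneg_of_mem hk hp hZ j) ⟨i, Finset.mem_univ i,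
    scalar_self_pos (hk i) (scalar_self_of_mem hp (hk i)) (hZ i (hk i)) hi⟩

theorem nondegenerate_of_pos {V : Type*} [AddCommGroup V] [Module ℝ V]
    (B : LinearMap.BilinForm ℝ V) (h : ∀ v, v ≠ 0 → 0 < B v v) : B.Nondegenerate := by
  constructor <;>
  · intro v hv
    by_contra h0
    exact (h v h0).ne' (hv v)

/-! ### The normal projection and the splitting of `ℝ^N` along `F`. -/

variable {m : ℕ} {M : Type*} [TopologicalSpace M]
  [ChartedSpace (EuclideanSpace ℝ (Fin m)) M]

/-- The flat form may be indefinite on `ℝ^N`; its positivity on the tangent spaces of `Ô` is what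
makes `normalProj` and `tensorS` genuine adjoints instead of the default `0`. -/
theorem normalForm_nondegenerate (hk : ∀ i, k i ≠ 0) {F : M → Ambient k n} {x : M}
    (hp : F x ∈ prodSpaceForm k n) : (normalForm m F x).Nondegenerate := by
  refine nondegenerate_of_pos _ fun v hv => ?_
  exact flat_self_pos hk hp v.2.1 fun h => hv (Subtype.ext h)

instance finiteDimensional_tangentSpace (x : M) :
    FiniteDimensional ℝ (TangentSpace (𝓡 m) x) :=
  inferInstanceAs (FiniteDimensional ℝ (EuclideanSpace ℝ (Fin m)))

/-- The normal projection of a vector whose decomposition along `T^⊥M`, `f_* TM` and the position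
vectors of the factors is known. -/
theorem normalProj_eq (hk : ∀ i, k i ≠ 0) {F : M → Ambient k n} {x : M}
    (hp : F x ∈ prodSpaceForm k n) {v : Ambient k n} (ζ : normalSpace m F x)
    (W : TangentSpace (𝓡 m) x) (c : Fin ℓ → ℝ)
    (h : v = ζ + push F x W + ∑ j, c j • proj k n j (F x)) : normalProj m F x v = ζ := by
  have hnd := normalForm_nondegenerate (m := m) hk hp
  refine sub_eq_zero.mp (hnd.1 _ fun ξ => ?_)
  rw [map_sub, LinearMap.sub_apply, normalProj,
    adjoint_apply _ _ hnd (normalSpace m F x).subtype v ξ, h]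
  have h1 : flat k n (push F x W) (ξ : Ambient k n) = 0 := by rw [flat_symm]; exact ξ.2.2 W
  have h2 : ∀ j, flat k n (proj k n j (F x)) (ξ : Ambient k n) = 0 := fun j => by
    rw [flat_proj_left]; exact ξ.2.1 j (hk j)
  simp [h1, h2, LinearMap.sum_apply, normalForm, LinearMap.BilinForm.restrict_apply]

theorem normalProj_push (hk : ∀ i, k i ≠ 0) {F : M → Ambient k n} {x : M}
    (hp : F x ∈ prodSpaceForm k n) (W : TangentSpace (𝓡 m) x) :
    normalProj m F x (push F x W) = 0 :=
  normalProj_eq hk hp 0 W 0 (by simp)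

/-- The component of `v` that is orthogonal to the position vectors and to `f_* TM`. -/
theorem sub_sub_mem_normalSpace (hk : ∀ i, k i ≠ 0) {F : M → Ambient k n} {x : M}
    (hp : F x ∈ prodSpaceForm k n) (ht : ∀ X : TangentSpace (𝓡 m) x, push F x X ∈ tangentProd k n (F x))
    {v : Ambient k n} {W : TangentSpace (𝓡 m) x}
    (hW : ∀ X : TangentSpace (𝓡 m) x, flat k n (push F x W) (push F x X) = flat k n v (push F x X)) :
    v - push F x W - ∑ j, (k j * flat k n v (proj k n j (F x))) • proj k n j (F x) ∈
      normalSpace m F x := by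
  have hsum : ∀ i (c : Fin ℓ → ℝ), (∑ j, c j • proj k n j (F x)) i = c i • F x i := by
    intro i c
    rw [Finset.sum_apply, Finset.sum_eq_single i]
    · rw [Pi.smul_apply, proj_same]
    · intro j _ hj
      rw [Pi.smul_apply, proj_of_ne hj.symm, smul_zero]
    · simp
  refine ⟨fun i hi => ?_, fun X => ?_⟩
  · have h1 := ht W i hi
    rw [Pi.sub_apply, Pi.sub_apply, hsum, map_sub, map_sub, h1, map_smul,
      scalar_self_of_mem hp hi, flat_proj_right, scalar_symm _ (v i)]
    simp only [smul_eq_mul]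
    field_simp
    ring
  · have h2 : ∀ j, flat k n (proj k n j (F x)) (push F x X) = 0 := fun j => by
      rw [flat_proj_left]; exact ht X j (hk j)
    rw [map_sub, map_sub, LinearMap.sub_apply, LinearMap.sub_apply, hW X, map_sum,
      LinearMap.sum_apply, sub_self, Finset.sum_eq_zero, sub_zero]
    intro j _
    rw [map_smul, LinearMap.smul_apply, h2, smul_zero]

/-- An explicit formula for the normal projection. -/
theorem coe_normalProj (hk : ∀ i, k i ≠ 0) {F : M → Ambient k n} {x : M}
    (hp : F x ∈ prodSpaceForm k n) (ht : ∀ X : TangentSpace (𝓡 m) x, push F x X ∈ tangentProd k n (F x))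
    {v : Ambient k n} {W : TangentSpace (𝓡 m) x}
    (hW : ∀ X : TangentSpace (𝓡 m) x, flat k n (push F x W) (push F x X) = flat k n v (push F x X)) :
    (normalProj m F x v : Ambient k n) =
      v - push F x W - ∑ j, (k j * flat k n v (proj k n j (F x))) • proj k n j (F x) := by
  rw [normalProj_eq hk hp ⟨_, sub_sub_mem_normalSpace hk hp ht hW⟩ W
    (fun j => k j * flat k n v (proj k n j (F x))) (by simp only []; abel)]

variable [IsManifold (𝓡 m) ∞ M]

theorem metricForm_nondegenerate (g : RiemMetric m M) (x : M) : (metricForm g x).Nondegenerate :=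
  nondegenerate_of_pos _ fun v hv => g.pos x v hv

theorem metricForm_tensorR (g : RiemMetric m M) (F : M → Ambient k n) (i : Fin ℓ) (x : M)
    (X Y : TangentSpace (𝓡 m) x) :
    metricForm g x (tensorR g F i x X) Y =
      flat k n (proj k n i (push F x X)) (proj k n i (push F x Y)) :=
  adjoint_apply _ _ (metricForm_nondegenerate g x) _ _ _

/-- The decomposition of a vector along `T^⊥M`, `f_* TM` and the position vectors. -/
theorem exists_eq_normalProj_add (hk : ∀ i, k i ≠ 0) {g : RiemMetric m M} {F : M → Ambient k n}
    (hF : IsIsometricImmersion g F) {x : M}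
    (ht : ∀ X : TangentSpace (𝓡 m) x, push F x X ∈ tangentProd k n (F x)) (v : Ambient k n) :
    ∃ (W : TangentSpace (𝓡 m) x) (c : Fin ℓ → ℝ),
      v = normalProj m F x v + push F x W + ∑ j, c j • proj k n j (F x) := by
  refine ⟨adjoint (metricForm g x) (flat k n) (push F x) v,
    fun j => k j * flat k n v (proj k n j (F x)), ?_⟩
  rw [coe_normalProj hk (hF.mem x) ht
    (W := adjoint (metricForm g x) (flat k n) (push F x) v)]
  · abel
  · intro X
    rw [hF.isometric]
    exact adjoint_apply _ _ (metricForm_nondegenerate g x) _ _ _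

/-! ### The form measuring the failure of `π_i` to be a similarity -/

/-- The bilinear form `⟨π_i Z, π_i W⟩ - c ⟨Z, W⟩`. -/
def defect (k : Fin ℓ → ℝ) (n : Fin ℓ → ℕ) (i : Fin ℓ) (c : ℝ) :
    LinearMap.BilinForm ℝ (Ambient k n) :=
  (flat k n).compl₁₂ (proj k n i) (proj k n i) - c • flat k n

theorem defect_apply (i : Fin ℓ) (c : ℝ) (Z W : Ambient k n) :
    defect k n i c Z W = flat k n (proj k n i Z) (proj k n i W) - c * flat k n Z W := rfl

theorem defect_symm (i : Fin ℓ) (c : ℝ) (Z W : Ambient k n) :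
    defect k n i c Z W = defect k n i c W Z := by
  rw [defect_apply, defect_apply, flat_symm Z, flat_symm (proj k n i Z)]

/-- Different factors are orthogonal, and within one factor the position vector is orthogonal to the
tangent space, so both terms of the form vanish. -/
theorem defect_position (hk : ∀ i, k i ≠ 0) (i : Fin ℓ) (c : ℝ) {p Z : Ambient k n}
    (hZ : Z ∈ tangentProd k n p) (d : Fin ℓ → ℝ) :
    defect k n i c (∑ j, d j • proj k n j p) Z = 0 := by
  rw [map_sum, LinearMap.sum_apply]
  refine Finset.sum_eq_zero fun j _ => ?_
  rw [map_smul, LinearMap.smul_apply, defect_apply, flat_proj_proj, flat_proj_left, hZ j (hk j)]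
  rcases eq_or_ne i j with rfl | h
  · rw [proj_same, hZ i (hk i)]; simp
  · rw [proj_of_ne h]; simp

end LinearAlgebra

section Charts

/-! ### Calculus in a vector space -/

section Calculus

variable {E V : Type*} [NormedAddCommGroup E] [NormedSpace ℝ E] [NormedAddCommGroup V]
  [NormedSpace ℝ V] [FiniteDimensional ℝ V] (B : LinearMap.BilinForm ℝ V)

theorem add_eq_zero_of_eventually_const {f g : E → V} {f' g' : E →L[ℝ] V} {u : E} {c : ℝ}
    (hf : HasFDerivAt f f' u) (hg : HasFDerivAt g g' u)
    (h : ∀ᶠ w in 𝓝 u, B (f w) (g w) = c) (X : E) : B (f u) (g' X) + B (f' X) (g u) = 0 := by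
  have h1 := B.toContinuousBilinearMap.hasFDerivAt_of_bilinear hf hg
  have h2 : HasFDerivAt (fun w => B.toContinuousBilinearMap (f w) (g w)) (0 : E →L[ℝ] ℝ) u :=
    (hasFDerivAt_const c u).congr_of_eventuallyEq h
  have h3 := congrArg (fun A => A X) (h1.unique h2)
  simpa using h3

omit [FiniteDimensional ℝ V] in
theorem hasFDerivAt_fderiv_apply {Φ : E → V} {u : E} (hΦ : ContDiffAt ℝ ∞ Φ u) (Y : E) :
    HasFDerivAt (fun w => fderiv ℝ Φ w Y) ((fderiv ℝ (fderiv ℝ Φ) u).flip Y) u := by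
  have hd : HasFDerivAt (fderiv ℝ Φ) (fderiv ℝ (fderiv ℝ Φ) u) u :=
    ((hΦ.fderiv_right (m := ∞) (by simp)).differentiableAt (by simp)).hasFDerivAt
  simpa using hd.clm_apply (hasFDerivAt_const Y u)

/-- A map pulling back a symmetric bilinear form to zero has second derivatives orthogonal to its
image, by the Koszul formula. -/
theorem apply_fderiv_fderiv_eq_zero (hB : ∀ v w, B v w = B w v) {Φ : E → V} {u : E}
    (hΦ : ContDiffAt ℝ ∞ Φ u)
    (h : ∀ᶠ w in 𝓝 u, ∀ X Y, B (fderiv ℝ Φ w X) (fderiv ℝ Φ w Y) = 0) (X Y Z : E) :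
    B (fderiv ℝ (fderiv ℝ Φ) u X Y) (fderiv ℝ Φ u Z) = 0 := by
  have hs : ∀ X Y, fderiv ℝ (fderiv ℝ Φ) u X Y = fderiv ℝ (fderiv ℝ Φ) u Y X :=
    fun X Y => (hΦ.isSymmSndFDerivAt (by simp only [minSmoothness_of_isRCLikeNormedField]; exact WithTop.coe_le_coe.mpr (le_top : (2 : ℕ∞) ≤ ⊤))).eq X Y
  have key : ∀ X Y Z, B (fderiv ℝ (fderiv ℝ Φ) u X Y) (fderiv ℝ Φ u Z) =
      -B (fderiv ℝ (fderiv ℝ Φ) u X Z) (fderiv ℝ Φ u Y) := fun X Y Z => by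
    have := add_eq_zero_of_eventually_const B
      (hasFDerivAt_fderiv_apply hΦ Y) (hasFDerivAt_fderiv_apply hΦ Z) (h.mono fun w hw => hw Y Z) X
    rw [hB] at this
    simp only [ContinuousLinearMap.flip_apply] at this
    linarith
  -- The trilinear expression is symmetric in its first two arguments and skew in the last two. One
  -- turn through the cyclic permutations changes its sign three times, so it equals its own
  -- negative.
  have h1 := key X Y Z
  have h2 := key Z X Y
  have h3 := key Y Z X
  rw [hs X Z] at h1
  rw [hs Z Y] at h2
  rw [hs Y X] at h3
  linarith

end Calculus

/-! ### Immersions in charts -/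

variable {ℓ : ℕ} {k : Fin ℓ → ℝ} {n : Fin ℓ → ℕ} {m : ℕ} {M : Type*} [TopologicalSpace M]
  [ChartedSpace (EuclideanSpace ℝ (Fin m)) M]

/-- The map `F` in the chart at `x`. -/
def inChart (F : M → Ambient k n) (x : M) : EuclideanSpace ℝ (Fin m) → Ambient k n :=
  F ∘ (extChartAt (𝓡 m) x).symm

/-- `mfderiv` at `x` is by definition computed in the chart at `x`, so no change of coordinates
appears at the base point. -/
theorem push_eq_fderiv {ξ : M → Ambient k n} {x : M}
    (hξ : MDifferentiableAt (𝓡 m) 𝓘(ℝ, Ambient k n) ξ x) (X : TangentSpace (𝓡 m) x) :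
    push ξ x X = fderiv ℝ (inChart ξ x) (extChartAt (𝓡 m) x x)
      (X : EuclideanSpace ℝ (Fin m)) := by
  have h : mfderiv (𝓡 m) 𝓘(ℝ, Ambient k n) ξ x =
      fderivWithin ℝ (inChart ξ x) (Set.range (𝓡 m)) (extChartAt (𝓡 m) x x) := hξ.mfderiv
  rw [ModelWithCorners.range_eq_univ, fderivWithin_univ] at h
  exact congrArg (fun A => A X) h

variable [IsManifold (𝓡 m) ∞ M]

theorem contMDiffAt_extChartAt_symm {x : M} {u : EuclideanSpace ℝ (Fin m)}
    (hu : u ∈ (extChartAt (𝓡 m) x).target) :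
    ContMDiffAt 𝓘(ℝ, EuclideanSpace ℝ (Fin m)) (𝓡 m) ∞ (extChartAt (𝓡 m) x).symm u :=
  (contMDiffOn_extChartAt_symm x).contMDiffAt ((isOpen_extChartAt_target x).mem_nhds hu)

theorem contDiffAt_inChart {F : M → Ambient k n} (hF : ContMDiff (𝓡 m) 𝓘(ℝ, Ambient k n) ∞ F)
    {x : M} {u : EuclideanSpace ℝ (Fin m)} (hu : u ∈ (extChartAt (𝓡 m) x).target) :
    ContDiffAt ℝ ∞ (inChart F x) u :=
  (hF.contMDiffAt.comp u (contMDiffAt_extChartAt_symm hu)).contDiffAt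

/-- The differential in the chart at `x` at an arbitrary point of its domain. -/
theorem exists_fderiv_inChart {F : M → Ambient k n}
    (hF : ContMDiff (𝓡 m) 𝓘(ℝ, Ambient k n) ∞ F)
    {x : M} {u : EuclideanSpace ℝ (Fin m)} (hu : u ∈ (extChartAt (𝓡 m) x).target)
    {y : M} (hy : (extChartAt (𝓡 m) x).symm u = y) :
    ∃ D : EuclideanSpace ℝ (Fin m) ≃L[ℝ] TangentSpace (𝓡 m) y,
      ∀ X, fderiv ℝ (inChart F x) u X = push F y (D X) := by
  subst hy
  have hinv := isInvertible_mfderivWithin_extChartAt_symm hu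
  rw [ModelWithCorners.range_eq_univ, mfderivWithin_univ] at hinv
  obtain ⟨D, hD⟩ := hinv
  refine ⟨D, fun X => ?_⟩
  have h := mfderiv_comp u (hF.mdifferentiableAt (by simp) :
      MDifferentiableAt (𝓡 m) 𝓘(ℝ, Ambient k n) F ((extChartAt (𝓡 m) x).symm u))
    ((contMDiffAt_extChartAt_symm hu).mdifferentiableAt (by simp))
  rw [mfderiv_eq_fderiv, ← hD] at h
  exact congrArg (fun A => A X) h

/-- Second derivatives in two charts differ by a tangent vector and a change of arguments. -/
theorem exists_fderiv_fderiv_inChart {F : M → Ambient k n}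
    (hF : ContMDiff (𝓡 m) 𝓘(ℝ, Ambient k n) ∞ F)
    {x : M} {u : EuclideanSpace ℝ (Fin m)} (hu : u ∈ (extChartAt (𝓡 m) x).target)
    {y : M} (hy : (extChartAt (𝓡 m) x).symm u = y) (X Y : EuclideanSpace ℝ (Fin m)) :
    ∃ X' Y' W : TangentSpace (𝓡 m) y, fderiv ℝ (fderiv ℝ (inChart F x)) u X Y =
      fderiv ℝ (fderiv ℝ (inChart F y)) (extChartAt (𝓡 m) y y)
        (X' : EuclideanSpace ℝ (Fin m)) (Y' : EuclideanSpace ℝ (Fin m)) + push F y W := by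
  subst hy
  set y := (extChartAt (𝓡 m) x).symm u with hy
  set τ : EuclideanSpace ℝ (Fin m) → EuclideanSpace ℝ (Fin m) :=
    extChartAt (𝓡 m) y ∘ (extChartAt (𝓡 m) x).symm with hτdef
  have hτu : τ u = extChartAt (𝓡 m) y y := rfl
  have hτ : ContDiffAt ℝ ∞ τ u :=
    ((contMDiffAt_extChartAt (I := 𝓡 m) (n := ∞) (x := y)).comp u
      (contMDiffAt_extChartAt_symm hu)).contDiffAt
  have hyt : τ u ∈ (extChartAt (𝓡 m) y).target := mem_extChartAt_target y
  have hΨ : ContDiffAt ℝ ∞ (inChart F y) (τ u) := contDiffAt_inChart hF hyt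
  have hev1 : ∀ᶠ w in 𝓝 u, τ w ∈ (extChartAt (𝓡 m) y).target :=
    hτ.continuousAt ((isOpen_extChartAt_target y).mem_nhds hyt)
  have hev2 : ∀ᶠ w in 𝓝 u, ContDiffAt ℝ 1 τ w :=
    (hτ.of_le (by simp) : ContDiffAt ℝ 1 τ u).eventually (by simp)
  have hcont : ContinuousAt (extChartAt (𝓡 m) x).symm u :=
    (contMDiffAt_extChartAt_symm hu).continuousAt
  have hev3 : ∀ᶠ w in 𝓝 u, (extChartAt (𝓡 m) x).symm w ∈ (extChartAt (𝓡 m) y).source :=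
    hcont ((isOpen_extChartAt_source y).mem_nhds (mem_extChartAt_source y))
  have hev4 : inChart F x =ᶠ[𝓝 u] inChart F y ∘ τ := hev3.mono fun w hw => by
    simp only [inChart, Function.comp, hτdef]
    rw [(extChartAt (𝓡 m) y).left_inv hw]
  have hev5 : fderiv ℝ (inChart F x) =ᶠ[𝓝 u]
      fun w => (fderiv ℝ (inChart F y) (τ w)).comp (fderiv ℝ τ w) := by
    filter_upwards [hev1, hev2, hev4.eventuallyEq_nhds] with w h1 h2 h4
    rw [h4.fderiv_eq]
    exact fderiv_comp w ((contDiffAt_inChart hF h1).differentiableAt (by simp))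
      (h2.differentiableAt (by simp))
  have hd1 : HasFDerivAt (fderiv ℝ (inChart F y)) (fderiv ℝ (fderiv ℝ (inChart F y)) (τ u)) (τ u) :=
    ((hΨ.fderiv_right (m := ∞) (by simp)).differentiableAt (by simp)).hasFDerivAt
  have hd2 : HasFDerivAt (fderiv ℝ τ) (fderiv ℝ (fderiv ℝ τ) u) u :=
    ((hτ.fderiv_right (m := ∞) (by simp)).differentiableAt (by simp)).hasFDerivAt
  have hd3 : HasFDerivAt τ (fderiv ℝ τ u) u := (hτ.differentiableAt (by simp)).hasFDerivAt
  have hd := ((hd1.comp u hd3).clm_comp hd2).fderiv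
  -- Chain rule for `inChart F y ∘ τ`, with `τ` the transition map: the Hessian of `τ` enters only
  -- through `dF`, hence as a tangent vector.
  refine ⟨fderiv ℝ τ u X, fderiv ℝ τ u Y, fderiv ℝ (fderiv ℝ τ) u X Y, ?_⟩
  have h1 := push_eq_fderiv (hF.mdifferentiableAt (by simp) (x := y))
    (fderiv ℝ (fderiv ℝ τ) u X Y)
  have h2 : fderiv ℝ (fderiv ℝ (inChart F x)) u X Y =
      fderiv ℝ (fderiv ℝ (inChart F y)) (τ u) (fderiv ℝ τ u X) (fderiv ℝ τ u Y) +
        fderiv ℝ (inChart F y) (τ u) (fderiv ℝ (fderiv ℝ τ) u X Y) := by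
    rw [hev5.fderiv_eq]
    refine (congrArg (fun A => A X Y) hd).trans ?_
    simp [add_comm]
  exact h2.trans (congrArg (fun Z => _ + Z) h1.symm)

end Charts

section IsometricImmersions

variable {ℓ : ℕ} {k : Fin ℓ → ℝ} {n : Fin ℓ → ℕ} {m : ℕ} {M : Type*} [TopologicalSpace M]
  [ChartedSpace (EuclideanSpace ℝ (Fin m)) M] [IsManifold (𝓡 m) ∞ M] {g : RiemMetric m M}
  {F : M → Ambient k n}

/-! ### Isometric immersions into products of space forms -/

theorem push_mem_tangentProd (hF : IsIsometricImmersion g F) (x : M)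
    (X : TangentSpace (𝓡 m) x) : push F x X ∈ tangentProd k n (F x) := by
  intro i hi
  have hd := ((contDiffAt_inChart hF.smooth (mem_extChartAt_target (I := 𝓡 m) x)).differentiableAt
    (by simp)).hasFDerivAt
  -- This form is the scalar product of the `i`-th factor, constant equal to `1/k_i` along `F`.
  have h := add_eq_zero_of_eventually_const (flat k n ∘ₗ proj k n i) hd hd (c := 1 / k i)
    (Filter.Eventually.of_forall fun w => (flat_proj_left i _ _).trans
      (scalar_self_of_mem (hF.mem _) hi)) X
  have hx : inChart F x (extChartAt (𝓡 m) x x) = F x :=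
    congrArg F ((extChartAt (𝓡 m) x).left_inv (mem_extChartAt_source x))
  rw [← push_eq_fderiv (hF.smooth.mdifferentiableAt (by simp)), hx] at h
  simp only [LinearMap.comp_apply, flat_proj_left] at h
  rw [scalar_symm _ (push F x X i)] at h
  linarith

/-- A form `⟨π_i ·, π_i ·⟩ - c ⟨·, ·⟩` that vanishes on `f_* TM` only sees the normal part of
a vector when paired with `f_* TM`. -/
theorem defect_normalProj (hk : ∀ i, k i ≠ 0) (hF : IsIsometricImmersion g F) {i : Fin ℓ} {c : ℝ}
    {x : M} (hd : ∀ X Y : TangentSpace (𝓡 m) x, defect k n i c (push F x X) (push F x Y) = 0)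
    (v : Ambient k n) (Z : TangentSpace (𝓡 m) x) :
    defect k n i c (normalProj m F x v) (push F x Z) = defect k n i c v (push F x Z) := by
  obtain ⟨W, d, h⟩ := exists_eq_normalProj_add hk hF (push_mem_tangentProd hF x) v
  conv_rhs => rw [h]
  rw [map_add, map_add, LinearMap.add_apply, LinearMap.add_apply, hd,
    defect_position hk i c (push_mem_tangentProd hF x Z)]
  ring

theorem defect_fderiv_inChart (hF : IsIsometricImmersion g F) {i : Fin ℓ} {c : ℝ}
    (hd : ∀ x, ∀ X Y : TangentSpace (𝓡 m) x, defect k n i c (push F x X) (push F x Y) = 0)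
    {x : M} {u : EuclideanSpace ℝ (Fin m)} (hu : u ∈ (extChartAt (𝓡 m) x).target)
    (X Y : EuclideanSpace ℝ (Fin m)) :
    defect k n i c (fderiv ℝ (inChart F x) u X) (fderiv ℝ (inChart F x) u Y) = 0 := by
  obtain ⟨D, hD⟩ := exists_fderiv_inChart hF.smooth hu rfl
  rw [hD, hD, hd]

/-- On generators, `α(X, Y)` may be replaced by the full second derivative of `F`, to which the
Koszul argument applies. -/
theorem defect_firstNormal_push (hk : ∀ i, k i ≠ 0) (hF : IsIsometricImmersion g F) {i : Fin ℓ}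
    {c : ℝ}
    (hd : ∀ x, ∀ X Y : TangentSpace (𝓡 m) x, defect k n i c (push F x X) (push F x Y) = 0)
    {x : M} {ξ : normalSpace m F x} (hξ : ξ ∈ firstNormal m F x) (Z : TangentSpace (𝓡 m) x) :
    defect k n i c ξ (push F x Z) = 0 := by
  induction hξ using Submodule.span_induction with
  | mem ξ h =>
    obtain ⟨X, Y, rfl⟩ := h
    rw [secondForm, defect_normalProj hk hF (hd x),
      push_eq_fderiv (hF.smooth.mdifferentiableAt (by simp))]
    refine apply_fderiv_fderiv_eq_zero _ (defect_symm i c)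
      (contDiffAt_inChart hF.smooth (mem_extChartAt_target x)) ?_ X Y Z
    filter_upwards [(isOpen_extChartAt_target (I := 𝓡 m) x).mem_nhds (mem_extChartAt_target x)]
      with u hu X Y using defect_fderiv_inChart hF hd hu X Y
  | zero => simp
  | add ξ η _ _ h1 h2 => rw [Submodule.coe_add, map_add, LinearMap.add_apply, h1, h2, add_zero]
  | smul a ξ _ h => rw [Submodule.coe_smul, map_smul, LinearMap.smul_apply, h, smul_zero]

/-- `⟨ξ, S_i Z⟩ = ⟨π_i ξ, π_i f_* Z⟩`, and this is the defect form at `(ξ, f_* Z)` since `ξ ⊥ f_*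
TM`. -/
theorem normalForm_tensorS (hk : ∀ i, k i ≠ 0) (hF : IsIsometricImmersion g F) {i : Fin ℓ} {c : ℝ}
    (hd : ∀ x, ∀ X Y : TangentSpace (𝓡 m) x, defect k n i c (push F x X) (push F x Y) = 0)
    {x : M} {ξ : normalSpace m F x} (hξ : ξ ∈ firstNormal m F x) (Z : TangentSpace (𝓡 m) x) :
    normalForm m F x ξ (tensorS m F i x Z) = 0 := by
  have h := defect_firstNormal_push hk hF hd hξ Z
  rw [defect_apply, ξ.2.2 Z, mul_zero, sub_zero] at h
  refine (flat_symm _ _).trans ?_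
  refine (adjoint_apply _ _ (normalForm_nondegenerate hk (hF.mem x)) _ _ _).trans ?_
  exact (flat_symm _ _).trans h

/-! ### Smooth sections of the first normal spaces -/

section Gram

variable {E V : Type*} [NormedAddCommGroup E] [NormedSpace ℝ E] [FiniteDimensional ℝ E]
  [NormedAddCommGroup V] [NormedSpace ℝ V] [FiniteDimensional ℝ V]

/-- The pullback of a bilinear form, as a map to the dual space. -/
def gram (B : LinearMap.BilinForm ℝ V) (A : E →L[ℝ] V) : E →L[ℝ] E →L[ℝ] ℝ :=
  ((ContinuousLinearMap.compL ℝ E V ℝ).flip A) ∘L B.toContinuousBilinearMap ∘L A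

omit [FiniteDimensional ℝ E] in
theorem gram_apply (B : LinearMap.BilinForm ℝ V) (A : E →L[ℝ] V) (X Y : E) :
    gram B A X Y = B (A X) (A Y) := rfl

theorem gram_isInvertible (B : LinearMap.BilinForm ℝ V) (A : E →L[ℝ] V)
    (h : ∀ X, X ≠ 0 → 0 < B (A X) (A X)) : (gram B A).IsInvertible := by
  have hinj : Function.Injective (gram B A).toLinearMap := by
    refine (injective_iff_map_eq_zero _).mpr fun X hX => ?_
    by_contra h0
    exact (h X h0).ne' (congrArg (fun T : E →L[ℝ] ℝ => T X) hX)
  have hrank : Module.finrank ℝ E = Module.finrank ℝ (E →L[ℝ] ℝ) :=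
    Subspace.dual_finrank_eq.symm.trans
      (LinearMap.toContinuousLinearMap : (E →ₗ[ℝ] ℝ) ≃ₗ[ℝ] (E →L[ℝ] ℝ)).finrank_eq
  refine ⟨(LinearEquiv.ofInjectiveOfFinrankEq _ hinj hrank).toContinuousLinearEquiv, ?_⟩
  ext X Y
  rfl

/-- The vector `W` with `⟨A W, A X⟩ = ⟨v, A X⟩` for all `X`. -/
def gramSolve (B : LinearMap.BilinForm ℝ V) (A : E →L[ℝ] V) (v : V) : E :=
  (gram B A).inverse ((B.toContinuousBilinearMap v).comp A)

theorem gramSolve_spec (B : LinearMap.BilinForm ℝ V) (A : E →L[ℝ] V)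
    (h : ∀ X, X ≠ 0 → 0 < B (A X) (A X)) (v : V) (X : E) :
    B (A (gramSolve B A v)) (A X) = B v (A X) := by
  rw [← gram_apply, gramSolve]
  obtain ⟨e, he⟩ := gram_isInvertible B A h
  rw [← he, ContinuousLinearMap.inverse_equiv]
  simp

/-- `normalProj` comes from a pointwise choice of adjoints; its smooth dependence on the point is
read off from an explicit tangential part. Operator inversion is smooth at the invertible Gram
operator. -/
theorem contDiffAt_gramSolve (B : LinearMap.BilinForm ℝ V) {G : Type*} [NormedAddCommGroup G]
    [NormedSpace ℝ G] {A : G → E →L[ℝ] V} {v : G → V} {u : G} (hA : ContDiffAt ℝ ∞ A u)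
    (hv : ContDiffAt ℝ ∞ v u) (h : ∀ X, X ≠ 0 → 0 < B (A u X) (A u X)) :
    ContDiffAt ℝ ∞ (fun w => gramSolve B (A w) (v w)) u := by
  have h1 : ContDiffAt ℝ ∞ (fun w => gram B (A w)) u :=
    ((ContinuousLinearMap.contDiff _).contDiffAt.comp u hA).clm_comp
      (contDiffAt_const.clm_comp hA)
  obtain ⟨e, he⟩ := gram_isInvertible B (A u) h
  have h2 : ContDiffAt ℝ ∞ (fun w => (gram B (A w)).inverse) u := by
    refine ContDiffAt.comp u (g := ContinuousLinearMap.inverse) ?_ h1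
    rw [← he]
    exact contDiffAt_map_inverse e
  exact h2.clm_apply (((ContinuousLinearMap.contDiff _).contDiffAt.comp u hv).clm_comp hA)

end Gram

/-- The normal part of the second derivatives of `F` in the chart at `x`, in coordinates. -/
def secondFormInChart (F : M → Ambient k n) (x : M) (X Y u : EuclideanSpace ℝ (Fin m)) :
    Ambient k n :=
  fderiv ℝ (fderiv ℝ (inChart F x)) u X Y -
    fderiv ℝ (inChart F x) u (gramSolve (flat k n) (fderiv ℝ (inChart F x) u)
      (fderiv ℝ (fderiv ℝ (inChart F x)) u X Y)) -
    ∑ j, (k j * flat k n (fderiv ℝ (fderiv ℝ (inChart F x)) u X Y)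
      (proj k n j (inChart F x u))) • proj k n j (inChart F x u)

theorem flat_fderiv_inChart_pos (hF : IsIsometricImmersion g F) {x : M}
    {u : EuclideanSpace ℝ (Fin m)} (hu : u ∈ (extChartAt (𝓡 m) x).target)
    (X : EuclideanSpace ℝ (Fin m)) (hX : X ≠ 0) :
    0 < flat k n (fderiv ℝ (inChart F x) u X) (fderiv ℝ (inChart F x) u X) := by
  obtain ⟨D, hD⟩ := exists_fderiv_inChart hF.smooth hu rfl
  rw [hD, hF.isometric]
  exact g.pos _ _ ((map_ne_zero_iff D D.injective).mpr hX)

theorem contDiffAt_secondFormInChart (hF : IsIsometricImmersion g F) {x : M}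
    (X Y : EuclideanSpace ℝ (Fin m))
    {u : EuclideanSpace ℝ (Fin m)} (hu : u ∈ (extChartAt (𝓡 m) x).target) :
    ContDiffAt ℝ ∞ (secondFormInChart F x X Y) u := by
  have h0 := contDiffAt_inChart hF.smooth hu
  have h1 : ContDiffAt ℝ ∞ (fderiv ℝ (inChart F x)) u := h0.fderiv_right (by simp)
  have h2 : ContDiffAt ℝ ∞ (fderiv ℝ (fderiv ℝ (inChart F x))) u := h1.fderiv_right (by simp)
  have h3 : ContDiffAt ℝ ∞ (fun w => fderiv ℝ (fderiv ℝ (inChart F x)) w X Y) u :=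
    (h2.clm_apply contDiffAt_const).clm_apply contDiffAt_const
  have h4 : ∀ j, ContDiffAt ℝ ∞ (fun w => proj k n j (inChart F x w)) u := fun j =>
    (proj k n j).toContinuousLinearMap.contDiff.contDiffAt.comp u h0
  have h5 : ∀ j, ContDiffAt ℝ ∞ (fun w => flat k n (fderiv ℝ (fderiv ℝ (inChart F x)) w X Y)
      (proj k n j (inChart F x w))) u := fun j =>
    ((flat k n).toContinuousBilinearMap.contDiff.contDiffAt.comp u h3).clm_apply (h4 j)
  exact (h3.sub (h1.clm_apply
    (contDiffAt_gramSolve _ h1 h3 (flat_fderiv_inChart_pos hF hu)))).sub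
    (ContDiffAt.sum fun j _ => (contDiffAt_const.mul (h5 j)).fun_smul (h4 j))

theorem coe_normalProj_inChart (hk : ∀ i, k i ≠ 0) (hF : IsIsometricImmersion g F) {x y : M}
    (X Y : EuclideanSpace ℝ (Fin m))
    {u : EuclideanSpace ℝ (Fin m)} (hu : u ∈ (extChartAt (𝓡 m) x).target)
    (hy : (extChartAt (𝓡 m) x).symm u = y) :
    (normalProj m F y (fderiv ℝ (fderiv ℝ (inChart F x)) u X Y) : Ambient k n) =
      secondFormInChart F x X Y u := by
  obtain ⟨D, hD⟩ := exists_fderiv_inChart hF.smooth hu hy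
  have hFy : inChart F x u = F y := congrArg F hy
  rw [coe_normalProj hk (hF.mem y) (push_mem_tangentProd hF y)
    (W := D (gramSolve (flat k n) (fderiv ℝ (inChart F x) u)
      (fderiv ℝ (fderiv ℝ (inChart F x)) u X Y))), secondFormInChart, hD, hFy]
  intro Z
  obtain ⟨Z, rfl⟩ := D.surjective Z
  rw [← hD, ← hD]
  exact gramSolve_spec _ _ (flat_fderiv_inChart_pos hF hu) _ _

/-- `secondForm` at `y` uses the chart at `y`; passing from the chart at `x` adds a tangent vector,
which the normal projection kills. -/
theorem normalProj_inChart_mem_firstNormal (hk : ∀ i, k i ≠ 0) (hF : IsIsometricImmersion g F)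
    {x y : M} (X Y : EuclideanSpace ℝ (Fin m))
    {u : EuclideanSpace ℝ (Fin m)} (hu : u ∈ (extChartAt (𝓡 m) x).target)
    (hy : (extChartAt (𝓡 m) x).symm u = y) :
    normalProj m F y (fderiv ℝ (fderiv ℝ (inChart F x)) u X Y) ∈ firstNormal m F y := by
  obtain ⟨X', Y', W, h⟩ := exists_fderiv_fderiv_inChart hF.smooth hu hy X Y
  rw [h, map_add, normalProj_push hk (hF.mem y), add_zero]
  exact Submodule.subset_span ⟨X', Y', rfl⟩

/-! ### The similarity on the first normal spaces in the parallel case. -/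

theorem defect_secondForm (hk : ∀ i, k i ≠ 0) (hF : IsIsometricImmersion g F) {i : Fin ℓ} {c : ℝ}
    (hd : ∀ x, ∀ X Y : TangentSpace (𝓡 m) x, defect k n i c (push F x X) (push F x Y) = 0)
    (hpar : FirstNormalParallel m F) (x : M) (X Y W Z : EuclideanSpace ℝ (Fin m)) :
    defect k n i c (secondForm m F x X Y) (secondForm m F x W Z) = 0 := by
  let φ := extChartAt (𝓡 m) x
  -- The section extending `α(X, Y)`, with `X` and `Y` kept constant in the chart at `x`.
  let ζ : (y : M) → normalSpace m F y := fun y =>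
    normalProj m F y (fderiv ℝ (fderiv ℝ (inChart F x)) (φ y) X Y)
  have hζx : ζ x = secondForm m F x X Y := rfl
  have hζmem : ∀ y ∈ φ.source, ζ y ∈ firstNormal m F y := fun y hy =>
    normalProj_inChart_mem_firstNormal hk hF X Y (φ.map_source hy) (φ.left_inv hy)
  have hζeq : ∀ y ∈ φ.source, (ζ y : Ambient k n) = secondFormInChart F x X Y (φ y) :=
    fun y hy => coe_normalProj_inChart hk hF X Y (φ.map_source hy) (φ.left_inv hy)
  have hopen : IsOpen φ.source := isOpen_extChartAt_source x
  have hsmooth : ContMDiffOn (𝓡 m) 𝓘(ℝ, Ambient k n) ∞ (fun y => (ζ y : Ambient k n))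
      φ.source := by
    intro y hy
    refine ContMDiffWithinAt.congr (f := secondFormInChart F x X Y ∘ φ) ?_ hζeq (hζeq y hy)
    refine ContMDiffAt.contMDiffWithinAt ?_
    refine ContMDiffAt.comp y
      (contDiffAt_secondFormInChart hF X Y (φ.map_source hy)).contMDiffAt ?_
    exact contMDiffAt_extChartAt' (by rwa [← extChartAt_source (𝓡 m)])
  have hx : x ∈ φ.source := mem_extChartAt_source x
  have hnear : φ.target ∈ 𝓝 (φ x) :=
    (isOpen_extChartAt_target x).mem_nhds (mem_extChartAt_target x)
  have hcon := hpar φ.source ζ hopen hsmooth hζmem x hx W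
  have hζchart : inChart (fun y => (ζ y : Ambient k n)) x =ᶠ[𝓝 (φ x)]
      secondFormInChart F x X Y := by
    filter_upwards [hnear] with u hu
    exact (hζeq _ (φ.map_target hu)).trans (by rw [φ.right_inv hu])
  have hdiff : MDifferentiableAt (𝓡 m) 𝓘(ℝ, Ambient k n) (fun y => (ζ y : Ambient k n)) x :=
    ((hsmooth x hx).contMDiffAt (hopen.mem_nhds hx)).mdifferentiableAt (by simp)
  have hd1 : HasFDerivAt (inChart (fun y => (ζ y : Ambient k n)) x)
      (fderiv ℝ (inChart (fun y => (ζ y : Ambient k n)) x) (φ x)) (φ x) :=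
    (((contDiffAt_secondFormInChart hF X Y (mem_extChartAt_target x)).congr_of_eventuallyEq
      hζchart).differentiableAt (by simp)).hasFDerivAt
  have hΦ := contDiffAt_inChart hF.smooth (mem_extChartAt_target (I := 𝓡 m) x)
  have hd2 := hasFDerivAt_fderiv_apply hΦ Z
  have hconst : ∀ᶠ w in 𝓝 (φ x), defect k n i c (inChart (fun y => (ζ y : Ambient k n)) x w)
      (fderiv ℝ (inChart F x) w Z) = 0 := by
    filter_upwards [hnear] with u hu
    obtain ⟨D, hD⟩ := exists_fderiv_inChart hF.smooth hu rfl
    rw [hD]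
    exact defect_firstNormal_push hk hF hd (hζmem _ (φ.map_target hu)) _
  have hder := add_eq_zero_of_eventually_const _ hd1 hd2 hconst W
  have e1 : inChart (fun y => (ζ y : Ambient k n)) x (φ x) = secondForm m F x X Y := by
    refine hζchart.self_of_nhds.trans ((hζeq x hx).symm.trans ?_)
    rw [hζx]
  have e2 := push_eq_fderiv hdiff W
  have e3 := push_eq_fderiv (hF.smooth.mdifferentiableAt (by simp) (x := x)) Z
  -- Only the normal part `∇^⊥_W ζ` of the derivative is seen by the form, and parallelism puts it
  -- in `N_1`.
  have e4 : defect k n i c (push (fun y => (ζ y : Ambient k n)) x W) (push F x Z) = 0 :=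
    (defect_normalProj hk hF (hd x) _ Z).symm.trans (defect_firstNormal_push hk hF hd hcon Z)
  rw [e2, e3] at e4
  have e5 : defect k n i c (secondForm m F x X Y)
      (fderiv ℝ (fderiv ℝ (inChart F x)) (φ x) W Z) = 0 := by
    rw [← e1]
    exact (add_eq_left.mpr e4).symm.trans hder
  -- Of the second derivative along `W` and `Z`, the tangential and position parts pair to zero with
  -- `α(X, Y)`, leaving `α(W, Z)`.
  obtain ⟨T, d, h⟩ := exists_eq_normalProj_add hk hF (push_mem_tangentProd hF x)
    (fderiv ℝ (fderiv ℝ (inChart F x)) (φ x) W Z)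
  have hmem : secondForm m F x X Y ∈ firstNormal m F x := Submodule.subset_span ⟨X, Y, rfl⟩
  rw [h, map_add, map_add, defect_firstNormal_push hk hF hd hmem, defect_symm _ _ _ (∑ j, _),
    defect_position hk i c (secondForm m F x X Y).2.1, add_zero, add_zero] at e5
  exact e5

theorem defect_firstNormal (hk : ∀ i, k i ≠ 0) (hF : IsIsometricImmersion g F) {i : Fin ℓ} {c : ℝ}
    (hd : ∀ x, ∀ X Y : TangentSpace (𝓡 m) x, defect k n i c (push F x X) (push F x Y) = 0)
    (hpar : FirstNormalParallel m F) {x : M} {ξ η : normalSpace m F x}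
    (hξ : ξ ∈ firstNormal m F x) (hη : η ∈ firstNormal m F x) : defect k n i c ξ η = 0 := by
  induction hξ using Submodule.span_induction with
  | mem ξ h =>
    obtain ⟨X, Y, rfl⟩ := h
    induction hη using Submodule.span_induction with
    | mem η h =>
      obtain ⟨W, Z, rfl⟩ := h
      exact defect_secondForm hk hF hd hpar x X Y W Z
    | zero => simp
    | add ξ η _ _ h1 h2 => rw [Submodule.coe_add, map_add, h1, h2, add_zero]
    | smul a ξ _ h => rw [Submodule.coe_smul, map_smul, h, smul_zero]
  | zero => simp
  | add ξ η _ _ h1 h2 => rw [Submodule.coe_add, map_add, LinearMap.add_apply, h1, h2, add_zero]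
  | smul a ξ _ h => rw [Submodule.coe_smul, map_smul, LinearMap.smul_apply, h, smul_zero]

/-! ### The constants -/

theorem prodOthers_eq (hk : ∀ i, k i ≠ 0) (i : Fin ℓ) : prodOthers k i = (∏ j, k j) * (1 / k i) := by
  rw [prodOthers, ← Finset.mul_prod_erase _ _ (Finset.mem_univ i)]
  field_simp [hk i]

theorem lam_eq (hk : ∀ i, k i ≠ 0) : lam k = (∏ j, k j) * ∑ i, 1 / k i := by
  rw [lam, Finset.mul_sum]
  exact Finset.sum_congr rfl fun i _ => prodOthers_eq hk i

/-- The common factor `∏ k_j` cancels, so `λ_i` is the quotient of `‖π_i F‖²` by `‖F‖²`. -/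
theorem prodOthers_div_lam (hk : ∀ i, k i ≠ 0) (i : Fin ℓ) :
    prodOthers k i / lam k = (1 / k i) / ∑ j, 1 / k j := by
  rw [prodOthers_eq hk, lam_eq hk, mul_div_mul_left _ _ (Finset.prod_ne_zero_iff.mpr fun j _ => hk j)]

/-- The condition `k_i R_i = k_j R_j` determines the metrics induced by the projections. -/
theorem metricForm_eq (hk : ∀ i, k i ≠ 0) (hF : IsIsometricImmersion g F)
    (hR : ∀ i j x, k i • tensorR g F i x = k j • tensorR g F j x) (i : Fin ℓ) (x : M)
    (X Y : TangentSpace (𝓡 m) x) :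
    metricForm g x X Y =
      (k i * ∑ j, 1 / k j) * flat k n (proj k n i (push F x X)) (proj k n i (push F x Y)) := by
  have h : ∀ j, flat k n (proj k n j (push F x X)) (push F x Y) =
      k i * (1 / k j) * flat k n (proj k n i (push F x X)) (proj k n i (push F x Y)) := by
    intro j
    have h1 := congrArg (fun A => metricForm g x (A X) Y) (hR j i x)
    simp only [LinearMap.smul_apply, map_smul, metricForm_tensorR, smul_eq_mul] at h1
    rw [flat_proj_proj] at h1
    rw [flat_proj_left]
    have := hk j
    field_simp
    linarith
  rw [← hF.isometric, ← sum_flat_proj, Finset.sum_congr rfl fun j _ => h j, ← Finset.sum_mul,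
    ← Finset.mul_sum]

theorem exists_metricForm_pos (hm : 0 < m) (g : RiemMetric m M) (x : M) :
    ∃ X : TangentSpace (𝓡 m) x, 0 < metricForm g x X X :=
  ⟨(EuclideanSpace.single ⟨0, hm⟩ (1 : ℝ) : EuclideanSpace ℝ (Fin m)),
    g.pos x _ fun h => one_ne_zero (α := ℝ)
      ((PiLp.single_eq_same 2 _ _).symm.trans
        (congrArg (fun v : EuclideanSpace ℝ (Fin m) => v ⟨0, hm⟩) h))⟩

theorem sum_one_div_ne_zero (hm : 0 < m) [Nonempty M] (hk : ∀ i, k i ≠ 0)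
    (hF : IsIsometricImmersion g F)
    (hR : ∀ i j x, k i • tensorR g F i x = k j • tensorR g F j x) : ∑ j, 1 / k j ≠ 0 := by
  intro h0
  obtain ⟨X, hX⟩ := exists_metricForm_pos hm g (Classical.arbitrary M)
  -- For `ℓ = 0` the flat form is zero, which already contradicts the existence of a vector of
  -- positive length.
  rcases isEmpty_or_nonempty (Fin ℓ) with he | ⟨⟨i⟩⟩
  · rw [← hF.isometric, flat_apply, Finset.univ_eq_empty, Finset.sum_empty] at hX
    exact lt_irrefl _ hX
  · rw [metricForm_eq hk hF hR i, h0] at hX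
    simp at hX

theorem flat_proj_push (hm : 0 < m) [Nonempty M] (hk : ∀ i, k i ≠ 0)
    (hF : IsIsometricImmersion g F)
    (hR : ∀ i j x, k i • tensorR g F i x = k j • tensorR g F j x) (i : Fin ℓ) (x : M)
    (X Y : TangentSpace (𝓡 m) x) :
    flat k n (proj k n i (push F x X)) (proj k n i (push F x Y)) =
      prodOthers k i / lam k * metricForm g x X Y := by
  have h1 := sum_one_div_ne_zero hm hk hF hR
  have h2 := hk i
  rw [metricForm_eq hk hF hR i, prodOthers_div_lam hk]
  generalize ∑ j, 1 / k j = s at h1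
  field_simp

/-- Tangent vectors of each factor have nonnegative square, so `λ_i ≥ 0`; it is nonzero because
`1/k_i` is. -/
theorem prodOthers_div_lam_pos (hm : 0 < m) [Nonempty M] (hk : ∀ i, k i ≠ 0)
    (hF : IsIsometricImmersion g F)
    (hR : ∀ i j x, k i • tensorR g F i x = k j • tensorR g F j x) (i : Fin ℓ) :
    0 < prodOthers k i / lam k := by
  obtain ⟨X, hX⟩ := exists_metricForm_pos hm g (Classical.arbitrary M)
  have h1 := flat_proj_push hm hk hF hR i (Classical.arbitrary M) X X
  rw [flat_proj_proj] at h1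
  have h2 := scalar_nonneg_of_mem hk (hF.mem _) (push_mem_tangentProd hF _ X) i
  rw [h1] at h2
  refine lt_of_le_of_ne (nonneg_of_mul_nonneg_left h2 hX) (Ne.symm ?_)
  rw [prodOthers_div_lam hk]
  exact div_ne_zero (one_div_ne_zero (hk i)) (sum_one_div_ne_zero hm hk hF hR)

theorem flat_self_position (hk : ∀ i, k i ≠ 0) (hF : IsIsometricImmersion g F) (x : M) :
    flat k n (F x) (F x) = ∑ j, 1 / k j := by
  rw [flat_apply]
  exact Finset.sum_congr rfl fun i _ => scalar_self_of_mem (hF.mem x) (hk i)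

end IsometricImmersions

end ProdSpaceForms

end

/-! ### The seven claims. -/

open ProdSpaceForms in
theorem proposition3p22 {ℓ m : ℕ} (hm : 0 < m) (k : Fin ℓ → ℝ) (n : Fin ℓ → ℕ)
    (M : Type*) [TopologicalSpace M] [ChartedSpace (EuclideanSpace ℝ (Fin m)) M]
    [IsManifold (𝓡 m) ∞ M] [Nonempty M] (g : RiemMetric m M)
    (F : M → Ambient k n) (hF : IsIsometricImmersion g F)
    (hk : ∀ i, k i ≠ 0)
    (hR : ∀ i j x, k i • tensorR g F i x = k j • tensorR g F j x) :
    lam k ≠ 0 ∧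
    (∀ i x, tensorR g F i x = (prodOthers k i / lam k) • LinearMap.id) ∧
    (∀ i j, 0 < k i * k j) ∧
    (∀ i x, IsSimilarity (metricForm g x) (flat k n) (tensorL F i x) (ratio k i)) ∧
    (∀ i x, flat k n (proj k n i (F x)) (proj k n i (F x)) =
      ratio k i ^ 2 * flat k n (F x) (F x)) ∧
    (∀ i x, ∀ ξ ∈ firstNormal m F x, ∀ X, normalForm m F x ξ (tensorS m F i x X) = 0) ∧
    (FirstNormalParallel m F → ∀ i x,
      IsSimilarity ((normalForm m F x).restrict (firstNormal m F x)) (flat k n)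
        (tensorK m F i x ∘ₗ (firstNormal m F x).subtype) (ratio k i)) := by
  have hS := sum_one_div_ne_zero hm hk hF hR
  have hpos := prodOthers_div_lam_pos hm hk hF hR
  have hsq : ∀ i, ratio k i ^ 2 = prodOthers k i / lam k := fun i => Real.sq_sqrt (hpos i).le
  have hratio : ∀ i, 0 < ratio k i := fun i => Real.sqrt_pos.mpr (hpos i)
  have hd : ∀ i x, ∀ X Y : TangentSpace (𝓡 m) x,
      defect k n i (prodOthers k i / lam k) (push F x X) (push F x Y) = 0 := fun i x X Y => by
    rw [defect_apply, flat_proj_push hm hk hF hR, hF.isometric, sub_self]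
  refine ⟨?_, fun i x => ?_, fun i j => ?_, fun i x => ⟨hratio i, fun X Y => ?_⟩, fun i x => ?_,
    fun i x ξ hξ X => normalForm_tensorS hk hF (hd i) hξ X,
    fun hpar i x => ⟨hratio i, fun ξ η => ?_⟩⟩
  · rw [lam_eq hk]
    exact mul_ne_zero (Finset.prod_ne_zero_iff.mpr fun j _ => hk j) hS
  · refine LinearMap.ext fun X => sub_eq_zero.mp ((metricForm_nondegenerate g x).1 _ fun Y => ?_)
    rw [map_sub, LinearMap.sub_apply, metricForm_tensorR, flat_proj_push hm hk hF hR,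
      LinearMap.smul_apply, LinearMap.id_apply, map_smul, LinearMap.smul_apply, smul_eq_mul,
      sub_self]
  -- `λ_i λ_j = 1 / (k_i k_j s²)` with `s = ∑ 1/k_j`, so `k_i k_j` inherits its sign.
  · have h := mul_pos (hpos i) (hpos j)
    rw [prodOthers_div_lam hk, prodOthers_div_lam hk, div_mul_div_comm, one_div_mul_one_div,
      ← pow_two] at h
    exact one_div_pos.mp ((div_pos_iff_of_pos_right (by positivity)).mp h)
  · rw [hsq]
    exact flat_proj_push hm hk hF hR i x X Y
  · rw [hsq, prodOthers_div_lam hk, flat_self_position hk hF, div_mul_cancel₀ _ hS,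
      flat_proj_proj, scalar_self_of_mem (hF.mem x) (hk i)]
  · rw [hsq]
    exact sub_eq_zero.mp (defect_firstNormal hk hF (hd i) hpar ξ.2 η.2)
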